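/- Let $(M^{2n+1},\phi,\xi,\eta,g)$ be a smooth contact metric manifold: $\eta$ is a $1$-form with $\eta\wedge(d\eta)^n\neq 0$ everywhere and Reeb vector field $\xi$ (so $\eta(\xi)=1$, $d\eta(\xi,\cdot)=0$), $g$ is a Riemannian metric and $\phi$ a $(1,1)$-tensor field with $g(V,\xi)=\eta(V)$, $\phi^2=-I+\eta\otimes\xi$ and $d\eta(V,W)=g(V,\phi W)$ for all vector fields $V,W$, where $2\,d\eta(V,W)=V(\eta(W))-W(\eta(V))-\eta([V,W])$. Let $\mathcal D=\ker\eta$, let $(\cdot)_{\mathcal D}$ be the projection onto $\mathcal D$ along $\mathbb R\xi$, let $\hat\nabla$ be the Levi-Civita connection of $g$, and let $h=\tfrac12\mathcal L_\xi\phi$. There is a linear connection $\tilde\nabla$ on $M$ with $$\tilde\nabla_Z Z'=(\hat\nabla_Z Z')_{\mathcal D},\qquad \tilde\nabla_\xi Z=[\xi,Z],\qquad \tilde\nabla\xi=0\qquad (Z,Z'\in\Gamma(\mathcal D)).$$ It preserves $\mathcal D$, and it is the unique linear connection on $M$ preserving $\mathcal D$ (that is, $\nabla_V Z\in\Gamma(\mathcal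 D)$ for all $V\in\Gamma(TM)$, $Z\in\Gamma(\mathcal D)$) such that (i) $\tilde\nabla\xi=0$; (ii) its torsion is $\tilde T(V,W)=\tilde\nabla_VW-\tilde\nabla_WV-[V,W]=2\,d\eta(V,W)\,\xi$ for all $V,W\in\Gamma(TM)$; (iii) $(\tilde\nabla_Z g)(Z',Z'')=0$ for all $Z,Z',Z''\in\Gamma(\mathcal D)$. Furthermore, $M$ is K-contact (that is, $\mathcal L_\xi g=0$) if and only if $\tilde\nabla g=0$; and $M$ is Sasakian (that is, $[\phi,\phi]+2\,d\eta\otimes\xi=0$) if and only if $\tilde\nabla\phi=0$. In the Sasakian case $\tilde\nabla$ coincides with the Tanaka–Webster connection $${}^*\nabla_VW=\hat\nabla_VW+\eta(V)\phi W+\eta(W)(\phi V+\phi hV)+d\eta(V+hV,W)\,\xi .$$ -/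

import Mathlib

open Bundle
open scoped Manifold ContDiff

noncomputable section

namespace ContactMetric

section Fields

variable {E : Type*} [NormedAddCommGroup E] [NormedSpace ℝ E]
  {H : Type*} [TopologicalSpace H] (I : ModelWithCorners ℝ E H)
  (M : Type*) [TopologicalSpace M] [ChartedSpace H M]

/-- A vector field on `M`, given by its values. Smoothness is stated separately by `SmoothVF`. -/
abbrev VF : Type _ := Π x : M, TangentSpace I x

/-- A 1-form on `M`, given by its values. -/
abbrev OneForm : Type _ := Π x : M, TangentSpace I x →L[ℝ] ℝ

/-- A tensor field of type (1,1) on `M`, given by its values. -/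
abbrev EndField : Type _ := Π x : M, TangentSpace I x →L[ℝ] TangentSpace I x

end Fields

section Calculus

variable {E : Type*} [NormedAddCommGroup E] [NormedSpace ℝ E]
  {H : Type*} [TopologicalSpace H] {I : ModelWithCorners ℝ E H}
  {M : Type*} [TopologicalSpace M] [ChartedSpace H M]

/-- `V ∈ Γ(TM)`: the vector field `V` is of class `C^∞`. -/
def SmoothVF [IsManifold I ∞ M] (V : VF I M) : Prop :=
  ContMDiff I I.tangent ∞ (fun x ↦ (⟨x, V x⟩ : TangentBundle I M))

/-- The 1-form `η` is of class `C^∞`, as a section of `Hom(TM, ℝ)`. -/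
def SmoothForm [IsManifold I ∞ M] (η : OneForm I M) : Prop :=
  ContMDiff I (I.prod 𝓘(ℝ, E →L[ℝ] ℝ)) ∞
    (fun x ↦ TotalSpace.mk' (E →L[ℝ] ℝ)
      (E := fun x : M ↦ TangentSpace I x →L[ℝ] Trivial M ℝ x) x (η x))

/-- The (1,1)-tensor field `φ` is of class `C^∞`, as a section of `Hom(TM, TM)`. -/
def SmoothEnd [IsManifold I ∞ M] (φ : EndField I M) : Prop :=
  ContMDiff I (I.prod 𝓘(ℝ, E →L[ℝ] E)) ∞
    (fun x ↦ TotalSpace.mk' (E →L[ℝ] E)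
      (E := fun x : M ↦ TangentSpace I x →L[ℝ] TangentSpace I x) x (φ x))

/-- The vector field `φ V`. -/
def app (φ : EndField I M) (V : VF I M) : VF I M := fun x ↦ φ x (V x)

/-- The function `V(f)`, the derivative of `f` along the vector field `V`. -/
def dirDeriv (V : VF I M) (f : M → ℝ) : M → ℝ := fun x ↦ mvfderiv I f x (V x)

/-- The Lie bracket `[V, W]`. -/
abbrev bracket (V W : VF I M) : VF I M := VectorField.mlieBracket I V W

/-- The function `dη(V, W)`, with the normalisation
`2 dη(V, W) = V(η(W)) - W(η(V)) - η([V, W])`. -/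
def dOne (η : OneForm I M) (V W : VF I M) : M → ℝ := fun x ↦
  (dirDeriv V (fun y ↦ η y (W y)) x - dirDeriv W (fun y ↦ η y (V y)) x
    - η x (bracket V W x)) / 2

/-- `Z ∈ Γ(D)`: a smooth vector field tangent to the distribution `D = ker η`. -/
def SmoothHorizontal [IsManifold I ∞ M] (η : OneForm I M) (Z : VF I M) : Prop :=
  SmoothVF Z ∧ ∀ x, η x (Z x) = 0

/-- The vector field `h V`, where `h = (1/2) L_ξ φ`, that is
`2 h V = [ξ, φ V] - φ [ξ, V]`. -/
def hField (φ : EndField I M) (ξ V : VF I M) : VF I M := fun x ↦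
  (1 / 2 : ℝ) • (bracket ξ (app φ V) x - φ x (bracket ξ V x))

/-- The component `v - η(v) ξ` in `D = ker η` of a tangent vector `v`, with respect to
`TM = D ⊕ ℝ ξ`. -/
def projD (ξ : VF I M) (η : OneForm I M) (x : M) (v : TangentSpace I x) : TangentSpace I x :=
  v - η x v • ξ x

/-- The 1-form `η` on a manifold of dimension `2 n + 1` satisfies `η ∧ (dη)^n ≠ 0` everywhere.
The sum is, up to a positive constant depending only on `n` and on the normalisation of the wedge
product, the value of `η ∧ (dη)^n` on `v 0, …, v (2 n)`. -/
def IsContactForm [IsManifold I ∞ M] (n : ℕ) (η : OneForm I M) : Prop :=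
  ∀ x : M, ∃ v : Fin (2 * n + 1) → VF I M, (∀ i, SmoothVF (v i)) ∧
    ∑ σ : Equiv.Perm (Fin (2 * n + 1)), ((Equiv.Perm.sign σ : ℤ) : ℝ) *
      (η x (v (σ 0) x) *
        ∏ i : Fin n, dOne η (v (σ ⟨2 * (i : ℕ) + 1, by omega⟩))
          (v (σ ⟨2 * (i : ℕ) + 2, by omega⟩)) x) ≠ 0

/-- The contact metric structure `(φ, ξ, η, g)` is Sasakian: it is normal, that is
`N = [φ, φ] + 2 dη ⊗ ξ` vanishes, where
`[φ, φ](V, W) = φ² [V, W] + [φ V, φ W] - φ [φ V, W] - φ [V, φ W]`. -/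
def IsNormal [IsManifold I ∞ M] (φ : EndField I M) (ξ : VF I M) (η : OneForm I M) : Prop :=
  ∀ V W : VF I M, SmoothVF V → SmoothVF W → ∀ x,
    φ x (φ x (bracket V W x)) + bracket (app φ V) (app φ W) x
      - φ x (bracket (app φ V) W x) - φ x (bracket V (app φ W) x)
      + (2 * dOne η V W x) • ξ x = 0

end Calculus

section Connections

variable {E : Type*} [NormedAddCommGroup E] [NormedSpace ℝ E]
  {H : Type*} [TopologicalSpace H] {I : ModelWithCorners ℝ E H}
  {M : Type*} [TopologicalSpace M] [ChartedSpace H M] [IsManifold I ∞ M]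

variable (I M) in
/-- A linear connection on `M`: a covariant derivative on the tangent bundle. For a connection
`D`, the value of `∇_V W` at `x` is `D W x (V x)`. -/
abbrev Connection : Type _ := CovariantDerivative I E (TangentSpace I : M → Type _)

/-- The vector field `∇_V W`. -/
def nabla (D : Connection I M) (V W : VF I M) : VF I M := fun x ↦ D W x (V x)

/-- The connection is smooth: `∇_V W` is smooth for smooth `V`, `W`. -/
abbrev SmoothConnection (D : Connection I M) : Prop :=
  CovariantDerivative.ContMDiffCovariantDerivative D ∞

/-- `∇ ξ = 0`. -/
def ParallelVF (D : Connection I M) (ξ : VF I M) : Prop := ∀ x, D ξ x = 0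

/-- The connection preserves `D = ker η`: `∇_V Z ∈ Γ(D)` for all `V ∈ Γ(TM)`, `Z ∈ Γ(D)`. -/
def PreservesD (D : Connection I M) (η : OneForm I M) : Prop :=
  ∀ V Z : VF I M, SmoothVF V → SmoothHorizontal η Z → ∀ x, η x (nabla D V Z x) = 0

/-- `T(V, W) = 2 dη(V, W) ξ` for all vector fields `V`, `W`, where `T` is the torsion. -/
def HasContactTorsion [FiniteDimensional ℝ E] [CompleteSpace E]
    (D : Connection I M) (ξ : VF I M) (η : OneForm I M) : Prop :=
  ∀ V W : VF I M, SmoothVF V → SmoothVF W → ∀ x,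
    D.torsion x (V x) (W x) = (2 * dOne η V W x) • ξ x

/-- `∇ φ = 0`, that is `(∇_V φ) W = ∇_V (φ W) - φ (∇_V W) = 0`. -/
def ParallelEnd (D : Connection I M) (φ : EndField I M) : Prop :=
  ∀ V W : VF I M, SmoothVF V → SmoothVF W → ∀ x,
    nabla D V (app φ W) x - φ x (nabla D V W x) = 0

/-- The connection `∇̃` is given, in terms of the connection `∇̂`, by
`∇̃_Z Z' = (∇̂_Z Z')_D`, `∇̃_ξ Z = [ξ, Z]` and `∇̃ ξ = 0`, for `Z, Z' ∈ Γ(D)`. -/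
structure IsCanonical (ξ : VF I M) (η : OneForm I M)
    (LC D : Connection I M) : Prop where
  smooth : SmoothConnection D
  horizontal : ∀ Z Z' : VF I M, SmoothHorizontal η Z → SmoothHorizontal η Z' →
    ∀ x, nabla D Z Z' x = projD ξ η x (nabla LC Z Z' x)
  reeb : ∀ Z : VF I M, SmoothHorizontal η Z → ∀ x, nabla D ξ Z x = bracket ξ Z x
  parallel : ParallelVF D ξ

/-- The value `∇*_V W` of the (generalized) Tanaka-Webster connection, in terms of the
Levi-Civita connection `∇̂`:
`∇*_V W = ∇̂_V W + η(V) φ W + η(W) (φ V + φ h V) + dη(V + h V, W) ξ`. -/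
def tanakaWebster (φ : EndField I M) (ξ : VF I M) (η : OneForm I M) (LC : Connection I M)
    (V W : VF I M) : VF I M := fun x ↦
  nabla LC V W x + η x (V x) • φ x (W x)
    + η x (W x) • (φ x (V x) + φ x (hField φ ξ V x))
    + dOne η (V + hField φ ξ V) W x • ξ x

end Connections

section Riemannian

/- The Riemannian metric `g` is the inner product carried by the tangent spaces. -/
variable {E : Type*} [NormedAddCommGroup E] [NormedSpace ℝ E]
  {H : Type*} [TopologicalSpace H] {I : ModelWithCorners ℝ E H}
  {M : Type*} [TopologicalSpace M] [ChartedSpace H M] [IsManifold I ∞ M]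
  [RiemannianBundle (fun x : M ↦ TangentSpace I x)]

/-- The function `g(V, W)`. -/
def metric (V W : VF I M) : M → ℝ := fun x ↦ inner ℝ (V x) (W x)

/-- `(φ, ξ, η, g)` is a contact metric structure on a manifold of dimension `2 n + 1`:
`η` is a contact form with Reeb vector field `ξ`, and `g` is an associated metric with
structure tensor `φ`. -/
structure IsContactMetric (n : ℕ) (φ : EndField I M) (ξ : VF I M) (η : OneForm I M) :
    Prop where
  smooth_phi : SmoothEnd φ
  smooth_xi : SmoothVF ξ
  smooth_eta : SmoothForm η
  contact : IsContactForm n η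
  eta_xi : ∀ x, η x (ξ x) = 1
  dEta_xi : ∀ V : VF I M, SmoothVF V → ∀ x, dOne η ξ V x = 0
  metric_xi : ∀ V : VF I M, SmoothVF V → ∀ x, metric V ξ x = η x (V x)
  phi_sq : ∀ x (v : TangentSpace I x), φ x (φ x v) = -v + η x v • ξ x
  dEta_eq : ∀ V W : VF I M, SmoothVF V → SmoothVF W → ∀ x,
    dOne η V W x = metric V (app φ W) x

/-- The Reeb vector field `ξ` is Killing, that is `L_ξ g = 0` (K-contact condition). -/
def IsKContact (ξ : VF I M) : Prop :=
  ∀ V W : VF I M, SmoothVF V → SmoothVF W → ∀ x,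
    dirDeriv ξ (metric V W) x - metric (bracket ξ V) W x - metric V (bracket ξ W) x = 0

/-- `∇ g = 0`, that is `(∇_V g)(W, W') = V(g(W, W')) - g(∇_V W, W') - g(W, ∇_V W') = 0` for all
vector fields. -/
def ParallelMetric (D : Connection I M) : Prop :=
  ∀ V W W' : VF I M, SmoothVF V → SmoothVF W → SmoothVF W' → ∀ x,
    dirDeriv V (metric W W') x - metric (nabla D V W) W' x - metric W (nabla D V W') x = 0

/-- `(∇_Z g)(Z', Z'') = 0` for all `Z, Z', Z''` in `Γ(D)`, where `D = ker η`. -/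
def MetricAlongD (D : Connection I M) (η : OneForm I M) : Prop :=
  ∀ Z Z' Z'' : VF I M, SmoothHorizontal η Z → SmoothHorizontal η Z' → SmoothHorizontal η Z'' →
    ∀ x, dirDeriv Z (metric Z' Z'') x - metric (nabla D Z Z') Z'' x
      - metric Z' (nabla D Z Z'') x = 0

/-- `D` is the Levi-Civita connection of `g`: smooth, metric and torsion free. -/
structure IsLeviCivita [FiniteDimensional ℝ E] [CompleteSpace E] (D : Connection I M) :
    Prop where
  smooth : SmoothConnection D
  parallel : ParallelMetric D
  torsion_free : ∀ x (v w : TangentSpace I x), D.torsion x v w = 0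

end Riemannian

end ContactMetric

end

noncomputable section

namespace ContactMetric

open scoped Topology

section Smoothness

variable {E : Type*} [NormedAddCommGroup E] [NormedSpace ℝ E]
  {H : Type*} [TopologicalSpace H] {I : ModelWithCorners ℝ E H}
  {M : Type*} [TopologicalSpace M] [ChartedSpace H M] [IsManifold I ∞ M]

/-- The vector field `V` is of class `C^∞` at `x`. -/
abbrev SmoothVFAt (V : VF I M) (x : M) : Prop :=
  ContMDiffAt I I.tangent ∞ (fun x ↦ (⟨x, V x⟩ : TangentBundle I M)) x

/-- The vector field `V` is differentiable at `x`. -/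
abbrev DiffVFAt (V : VF I M) (x : M) : Prop :=
  MDifferentiableAt I I.tangent (fun x ↦ (⟨x, V x⟩ : TangentBundle I M)) x

lemma SmoothVFAt.diffVFAt {V : VF I M} {x : M} (h : SmoothVFAt V x) : DiffVFAt V x :=
  h.mdifferentiableAt (by simp)

lemma SmoothVFAt.eventually {V : VF I M} {x : M} (h : SmoothVFAt V x) :
    ∀ᶠ y in 𝓝 x, DiffVFAt V y := by
  have h1 : ContMDiffAt I I.tangent 1 (fun x ↦ (⟨x, V x⟩ : TangentBundle I M)) x :=
    h.of_le (by simp)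
  filter_upwards [(contMDiffAt_iff_contMDiffAt_nhds (by simp)).1 h1] with y hy
  exact ContMDiffAt.mdifferentiableAt hy one_ne_zero

lemma contMDiffAt_dirDeriv {f : M → ℝ} {V : VF I M} {x : M}
    (hf : ContMDiffAt I 𝓘(ℝ, ℝ) ∞ f x) (hV : SmoothVFAt V x) :
    ContMDiffAt I 𝓘(ℝ, ℝ) ∞ (dirDeriv V f) x := by
  have h1 := ContMDiffAt.mfderiv_const (m := ∞) hf (by simp)
  have h2 := ContMDiffAt.clm_apply_of_inCoordinates (E₁ := (TangentSpace I : M → Type _))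
    (E₂ := (TangentSpace 𝓘(ℝ, ℝ) : ℝ → Type _)) (b₁ := id) (b₂ := f)
    (ϕ := fun y ↦ mfderiv I 𝓘(ℝ, ℝ) f y) (v := V) h1 hV hf
  have h3 := (contMDiff_snd_tangentBundle_modelSpace ℝ 𝓘(ℝ, ℝ) (n := ∞)).contMDiffAt.comp x h2
  exact h3

lemma smoothVFAt_bracket [CompleteSpace E] {V W : VF I M} {x : M} (hV : SmoothVFAt V x)
    (hW : SmoothVFAt W x) : SmoothVFAt (bracket V W) x := by
  have : IsManifold I (minSmoothness ℝ 2) M := by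
    rw [minSmoothness_of_isRCLikeNormedField]; infer_instance
  have : IsManifold I (((⊤ : ℕ∞) : ℕ∞ω) + 1) M := by simpa using ‹IsManifold I ∞ M›
  exact ContMDiffAt.mlieBracket_vectorField (m := ⊤) (n := ⊤) hV hW (by simp)

/-- Every tangent vector is the value of a smooth vector field. -/
lemma exists_smoothVF [FiniteDimensional ℝ E] [T2Space M] {x : M} (v : TangentSpace I x) :
    ∃ V : VF I M, SmoothVF V ∧ V x = v := by
  obtain ⟨s, hs, hsm⟩ := FiberBundle.exists_contMDiffOn_extend (k := ∞) I E
    (V := (TangentSpace I : M → Type _)) v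
  obtain ⟨u, hus, huo, hxu⟩ := mem_nhds_iff.1 hs
  obtain ⟨f, -, hf⟩ := (SmoothBumpFunction.nhds_basis_tsupport (I := I) x).mem_iff.1
    (huo.mem_nhds hxu)
  refine ⟨(f : M → ℝ) • FiberBundle.extend E v, ?_, ?_⟩
  · exact ContMDiffOn.smul_section_of_tsupport (V := (TangentSpace I : M → Type _))
      f.contMDiff.contMDiffOn huo hf (hsm.mono hus)
  · simp

section Frame

variable [FiniteDimensional ℝ E]

variable (I) in
/-- The local frame near `x₀` given by the trivialization of `TM` at `x₀` and the standard basis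
of `E`. -/
def stdFrame (x₀ : M) (i : Fin (Module.finrank ℝ E)) : VF I M :=
  (trivializationAt E (TangentSpace I : M → Type _) x₀).localFrame (V := TangentSpace I)
    (Module.finBasis ℝ E) i

lemma smoothVFAt_stdFrame (x₀ : M) (i : Fin (Module.finrank ℝ E)) :
    SmoothVFAt (stdFrame I x₀ i) x₀ :=
  contMDiffAt_localFrame_of_mem (V := (TangentSpace I : M → Type _)) ∞
    (trivializationAt E (TangentSpace I : M → Type _) x₀) (Module.finBasis ℝ E) i
    (FiberBundle.mem_baseSet_trivializationAt' x₀)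

lemma _root_.ContinuousLinearMap.eq_sum_smulRight {G : Type*} [NormedAddCommGroup G]
    [NormedSpace ℝ G] {ι : Type*} [Fintype ι] (b : Module.Basis ι ℝ E) (T : E →L[ℝ] G) :
    T = ∑ i, (LinearMap.toContinuousLinearMap (b.coord i)).smulRight (T (b i)) := by
  ext v
  conv_lhs => rw [← b.sum_repr v]
  simp only [map_sum, map_smul]
  simp

/-- An endomorphism field is smooth at a point if it sends the fields of a local frame to smooth
fields. -/
lemma contMDiffAt_endField {φ : EndField I M} {x₀ : M}
    (h : ∀ V : VF I M, SmoothVFAt V x₀ → SmoothVFAt (app φ V) x₀) :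
    ContMDiffAt I (I.prod 𝓘(ℝ, E →L[ℝ] E)) ∞
      (fun x ↦ TotalSpace.mk' (E →L[ℝ] E)
        (E := fun x : M ↦ TangentSpace I x →L[ℝ] TangentSpace I x) x (φ x)) x₀ := by
  rw [contMDiffAt_hom_bundle]
  refine ⟨contMDiffAt_id, ?_⟩
  set e := trivializationAt E (TangentSpace I : M → Type _) x₀ with he
  set b := Module.finBasis ℝ E
  have key : ContMDiffAt I 𝓘(ℝ, E →L[ℝ] E) ∞ (fun x ↦ ∑ i,
      (LinearMap.toContinuousLinearMap (b.coord i)).smulRight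
        (e ⟨x, φ x (stdFrame I x₀ i x)⟩).2) x₀ := by
    refine contMDiffAt_finsetSum fun i _ ↦ ?_
    have h1 := (contMDiffAt_section (F := E) (E := (TangentSpace I : M → Type _)) x₀).1
      (h _ (smoothVFAt_stdFrame x₀ i))
    exact ((ContinuousLinearMap.smulRightL ℝ E E
      (LinearMap.toContinuousLinearMap (b.coord i))).contMDiff.contMDiffAt).comp x₀ h1
  refine key.congr_of_eventuallyEq ?_
  filter_upwards [e.open_baseSet.mem_nhds (FiberBundle.mem_baseSet_trivializationAt' x₀)]
    with x hx
  rw [ContinuousLinearMap.eq_sum_smulRight b (ContinuousLinearMap.inCoordinates _ _ _ _ _ _ _ _ _)]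
  refine Finset.sum_congr rfl fun i _ ↦ ?_
  congr 1
  rw [ContinuousLinearMap.inCoordinates_eq hx hx]
  simp [stdFrame, ← he, hx, Trivialization.basisAt, b]

variable [RiemannianBundle (fun x : M ↦ TangentSpace I x)]
  [IsContMDiffRiemannianBundle I ∞ E (fun x : M ↦ TangentSpace I x)]

omit [FiniteDimensional ℝ E] in
lemma contMDiffAt_metric {V W : VF I M} {x : M} (hV : SmoothVFAt V x) (hW : SmoothVFAt W x) :
    ContMDiffAt I 𝓘(ℝ, ℝ) ∞ (metric V W) x :=
  ContMDiffAt.inner_bundle (E := fun x : M ↦ TangentSpace I x) hV hW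

/-- The Gram operator of the local frame near `x₀`, as an endomorphism of the model space. -/
def gramOp (x₀ y : M) : E →L[ℝ] E :=
  ∑ i, ∑ j, metric (stdFrame I x₀ i) (stdFrame I x₀ j) y •
    (LinearMap.toContinuousLinearMap ((Module.finBasis ℝ E).coord i)).smulRight
      (Module.finBasis ℝ E j)

omit [IsContMDiffRiemannianBundle I ∞ E (fun x : M ↦ TangentSpace I x)] in
lemma gramOp_apply {x₀ y : M}
    (hy : y ∈ (trivializationAt E (TangentSpace I : M → Type _) x₀).baseSet)
    (w : TangentSpace I y) :
    gramOp (I := I) x₀ y (trivializationAt E (TangentSpace I : M → Type _) x₀ ⟨y, w⟩).2 =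
      ∑ j, (inner ℝ w (stdFrame I x₀ j y) : ℝ) • Module.finBasis ℝ E j := by
  set e := trivializationAt E (TangentSpace I : M → Type _) x₀ with he
  have hw : w = ∑ i, (Module.finBasis ℝ E).repr (e ⟨y, w⟩).2 i • stdFrame I x₀ i y := by
    conv_lhs => rw [← (e.basisAt (Module.finBasis ℝ E) hy).sum_repr w]
    simp [Trivialization.basisAt, stdFrame, ← he, hy]
  rw [gramOp]
  conv_rhs => rw [hw]
  rw [sum_apply]
  simp only [sum_apply, sum_inner, Finset.sum_smul]
  rw [Finset.sum_comm]
  refine Finset.sum_congr rfl fun j _ ↦ Finset.sum_congr rfl fun i _ ↦ ?_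
  simp [metric, inner_smul_left, smul_smul, mul_comm]

omit [IsContMDiffRiemannianBundle I ∞ E (fun x : M ↦ TangentSpace I x)] in
lemma isInvertible_gramOp {x₀ y : M}
    (hy : y ∈ (trivializationAt E (TangentSpace I : M → Type _) x₀).baseSet) :
    (gramOp (I := I) x₀ y).IsInvertible := by
  set e := trivializationAt E (TangentSpace I : M → Type _) x₀ with he
  have hinj : Function.Injective (gramOp (I := I) x₀ y) := by
    rw [injective_iff_map_eq_zero]
    intro v hv
    obtain ⟨w, rfl⟩ : ∃ w : TangentSpace I y, (e ⟨y, w⟩).2 = v :=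
      ⟨(e.linearEquivAt ℝ y hy).symm v, (e.linearEquivAt ℝ y hy).apply_symm_apply v⟩
    rw [gramOp_apply hy] at hv
    have h0 : ∀ j, inner ℝ w (stdFrame I x₀ j y) = 0 := fun j ↦ by
      have := congrArg (fun u ↦ (Module.finBasis ℝ E).repr u j) hv
      simpa [Finsupp.single_apply] using this
    have : w = 0 := by
      have h1 : inner ℝ w (∑ j, (e.basisAt (Module.finBasis ℝ E) hy).repr w j •
          e.basisAt (Module.finBasis ℝ E) hy j) = 0 := by
        rw [inner_sum]
        refine Finset.sum_eq_zero fun j _ ↦ ?_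
        have := h0 j
        simp only [stdFrame, ← he, e.localFrame_apply_of_mem_baseSet _ hy] at this
        rw [inner_smul_right, this, mul_zero]
      rw [(e.basisAt (Module.finBasis ℝ E) hy).sum_repr] at h1
      exact inner_self_eq_zero.1 h1
    rw [this]
    exact (e.linearEquivAt ℝ y hy).map_zero
  refine ⟨ContinuousLinearEquiv.ofBijective (gramOp (I := I) x₀ y) (LinearMap.ker_eq_bot.2 hinj)
    (LinearMap.range_eq_top.2 (LinearMap.injective_iff_surjective.1 hinj)), ?_⟩
  ext v
  rfl

/-- A vector field is smooth at a point if its inner products with smooth fields are smooth. -/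
lemma smoothVFAt_of_metric {W : VF I M} {x₀ : M}
    (h : ∀ Z : VF I M, SmoothVFAt Z x₀ → ContMDiffAt I 𝓘(ℝ, ℝ) ∞ (metric W Z) x₀) :
    SmoothVFAt W x₀ := by
  have hx₀ := FiberBundle.mem_baseSet_trivializationAt' (F := E)
    (E := (TangentSpace I : M → Type _)) x₀
  set e := trivializationAt E (TangentSpace I : M → Type _) x₀ with he
  refine (contMDiffAt_section (F := E) (E := (TangentSpace I : M → Type _)) x₀).2 ?_
  have hG : ContMDiffAt I 𝓘(ℝ, E →L[ℝ] E) ∞ (gramOp (I := I) x₀) x₀ := by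
    refine contMDiffAt_finsetSum fun i _ ↦ contMDiffAt_finsetSum fun j _ ↦ ?_
    exact (contMDiffAt_metric (smoothVFAt_stdFrame x₀ i) (smoothVFAt_stdFrame x₀ j)).smul
      contMDiffAt_const
  have hinv : ContMDiffAt I 𝓘(ℝ, E →L[ℝ] E) ∞
      (fun y ↦ (gramOp (I := I) x₀ y).inverse) x₀ :=
    ((isInvertible_gramOp hx₀).contDiffAt_map_inverse (n := ∞)).contMDiffAt.comp x₀ hG
  have hu : ContMDiffAt I 𝓘(ℝ, E) ∞
      (fun y ↦ ∑ j, metric W (stdFrame I x₀ j) y • Module.finBasis ℝ E j) x₀ :=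
    contMDiffAt_finsetSum fun j _ ↦ (h _ (smoothVFAt_stdFrame x₀ j)).smul contMDiffAt_const
  refine (hinv.clm_apply hu).congr_of_eventuallyEq ?_
  filter_upwards [e.open_baseSet.mem_nhds hx₀] with y hy
  have h1 := gramOp_apply hy (W y)
  obtain ⟨A, hA⟩ := isInvertible_gramOp hy
  simp only [metric]
  rw [← h1, ← hA, ContinuousLinearMap.inverse_equiv]
  simp

end Frame

end Smoothness

section Koszul

set_option linter.unusedSectionVars false

variable {E : Type*} [NormedAddCommGroup E] [NormedSpace ℝ E] [FiniteDimensional ℝ E]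
  [CompleteSpace E]
  {H : Type*} [TopologicalSpace H] {I : ModelWithCorners ℝ E H}
  {M : Type*} [TopologicalSpace M] [ChartedSpace H M] [IsManifold I ∞ M]

lemma bracket_add_left {V V' W : VF I M} {x : M} (hV : DiffVFAt V x) (hV' : DiffVFAt V' x) :
    bracket (V + V') W x = bracket V W x + bracket V' W x :=
  VectorField.mlieBracket_add_left hV hV'

lemma bracket_add_right {V W W' : VF I M} {x : M} (hW : DiffVFAt W x) (hW' : DiffVFAt W' x) :
    bracket V (W + W') x = bracket V W x + bracket V W' x :=
  VectorField.mlieBracket_add_right hW hW'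

lemma bracket_smul_left {V W : VF I M} {f : M → ℝ} {x : M}
    (hf : MDifferentiableAt I 𝓘(ℝ, ℝ) f x) (hV : DiffVFAt V x) :
    bracket (f • V) W x = -dirDeriv W f x • V x + f x • bracket V W x :=
  VectorField.mlieBracket_smul_left hf hV

lemma bracket_smul_right {V W : VF I M} {f : M → ℝ} {x : M}
    (hf : MDifferentiableAt I 𝓘(ℝ, ℝ) f x) (hW : DiffVFAt W x) :
    bracket V (f • W) x = dirDeriv V f x • W x + f x • bracket V W x :=
  VectorField.mlieBracket_smul_right hf hW

lemma bracket_swap (V W : VF I M) (x : M) : bracket V W x = -bracket W V x :=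
  VectorField.mlieBracket_swap_apply

lemma SmoothVF.smoothVFAt {V : VF I M} (hV : SmoothVF V) (x : M) : SmoothVFAt V x := hV x

lemma SmoothVF.diffVFAt {V : VF I M} (hV : SmoothVF V) (x : M) : DiffVFAt V x :=
  (hV.smoothVFAt x).diffVFAt

variable [RiemannianBundle (fun x : M ↦ TangentSpace I x)]

lemma metric_comm (V W : VF I M) : metric V W = metric W V :=
  funext fun _ ↦ real_inner_comm _ _

variable [IsContMDiffRiemannianBundle I ∞ E (fun x : M ↦ TangentSpace I x)]

lemma mdifferentiableAt_metric {V W : VF I M} {x : M} (hV : DiffVFAt V x) (hW : DiffVFAt W x) :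
    MDifferentiableAt I 𝓘(ℝ, ℝ) (metric V W) x :=
  MDifferentiableAt.inner_bundle (E := fun x : M ↦ TangentSpace I x) hV hW

lemma dirDeriv_metric_add_left {U V V' W : VF I M} {x : M} (hV : DiffVFAt V x)
    (hV' : DiffVFAt V' x) (hW : DiffVFAt W x) :
    dirDeriv U (metric (V + V') W) x =
      dirDeriv U (metric V W) x + dirDeriv U (metric V' W) x := by
  have : metric (V + V') W = metric V W + metric V' W :=
    funext fun y ↦ inner_add_left _ _ _
  rw [this, dirDeriv, mvfderiv_add (mdifferentiableAt_metric hV hW)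
    (mdifferentiableAt_metric hV' hW)]
  rfl

lemma dirDeriv_metric_add_right {U V W W' : VF I M} {x : M} (hV : DiffVFAt V x)
    (hW : DiffVFAt W x) (hW' : DiffVFAt W' x) :
    dirDeriv U (metric V (W + W')) x =
      dirDeriv U (metric V W) x + dirDeriv U (metric V W') x := by
  rw [metric_comm, dirDeriv_metric_add_left hW hW' hV, metric_comm W, metric_comm W']

lemma dirDeriv_metric_smul_left {U V W : VF I M} {f : M → ℝ} {x : M}
    (hf : MDifferentiableAt I 𝓘(ℝ, ℝ) f x) (hV : DiffVFAt V x) (hW : DiffVFAt W x) :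
    dirDeriv U (metric (f • V) W) x =
      f x * dirDeriv U (metric V W) x + dirDeriv U f x * inner ℝ (V x) (W x) := by
  have : metric (f • V) W = f * metric V W :=
    funext fun y ↦ real_inner_smul_left _ _ _
  rw [this, dirDeriv, mvfderiv_mul hf (mdifferentiableAt_metric hV hW)]
  simp [dirDeriv, metric, mul_comm]

lemma dirDeriv_metric_smul_right {U V W : VF I M} {f : M → ℝ} {x : M}
    (hf : MDifferentiableAt I 𝓘(ℝ, ℝ) f x) (hV : DiffVFAt V x) (hW : DiffVFAt W x) :
    dirDeriv U (metric V (f • W)) x =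
      f x * dirDeriv U (metric V W) x + dirDeriv U f x * inner ℝ (V x) (W x) := by
  rw [metric_comm, dirDeriv_metric_smul_left hf hW hV, metric_comm W, real_inner_comm]

lemma dirDeriv_add_field (V V' : VF I M) (f : M → ℝ) (x : M) :
    dirDeriv (V + V') f x = dirDeriv V f x + dirDeriv V' f x :=
  map_add _ _ _

lemma dirDeriv_smul_field (V : VF I M) (f g : M → ℝ) (x : M) :
    dirDeriv (f • V) g x = f x * dirDeriv V g x :=
  map_smul (mvfderiv I g x) (f x) (V x)

/-- The right-hand side of the Koszul formula for `2 g(∇_X Y, Z)`. -/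
def koszul (Y X Z : VF I M) (x : M) : ℝ :=
  dirDeriv X (metric Y Z) x + dirDeriv Y (metric X Z) x - dirDeriv Z (metric X Y) x
    + inner ℝ (bracket X Y x) (Z x) - inner ℝ (bracket X Z x) (Y x)
    - inner ℝ (bracket Y Z x) (X x)

lemma tensorialAt_koszul_left {Y Z : VF I M} {x : M} (hY : DiffVFAt Y x) (hZ : DiffVFAt Z x) :
    TensorialAt I E (fun X ↦ koszul Y X Z x) x where
  smul {f X} hf hX := by
    simp only [koszul, dirDeriv_metric_smul_left hf hX hY, dirDeriv_metric_smul_left hf hX hZ,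
      bracket_smul_left hf hX, dirDeriv_smul_field, inner_add_left, inner_smul_left,
      inner_smul_right, Pi.smul_apply', smul_eq_mul, real_inner_comm (X x), conj_trivial]
    rw [real_inner_comm (Y x)]
    ring
  add {X X'} hX hX' := by
    simp only [koszul, dirDeriv_metric_add_left hX hX' hY, dirDeriv_metric_add_left hX hX' hZ,
      bracket_add_left hX hX', dirDeriv_add_field, inner_add_left, inner_add_right, Pi.add_apply]
    ring

lemma tensorialAt_koszul_right {Y X : VF I M} {x : M} (hY : DiffVFAt Y x) (hX : DiffVFAt X x) :
    TensorialAt I E (fun Z ↦ koszul Y X Z x) x where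
  smul {f Z} hf hZ := by
    simp only [koszul, dirDeriv_metric_smul_right hf hX hZ, dirDeriv_metric_smul_right hf hY hZ,
      bracket_smul_right hf hZ, dirDeriv_smul_field, inner_add_left, inner_smul_left,
      inner_smul_right, Pi.smul_apply', smul_eq_mul, conj_trivial]
    rw [real_inner_comm (Z x) (X x), real_inner_comm (Z x) (Y x)]
    ring
  add {Z Z'} hZ hZ' := by
    simp only [koszul, dirDeriv_metric_add_right hX hZ hZ', dirDeriv_metric_add_right hY hZ hZ',
      bracket_add_right hZ hZ', dirDeriv_add_field, inner_add_left, inner_add_right, Pi.add_apply]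
    ring

lemma koszul_add {Y Y' X Z : VF I M} {x : M} (hY : DiffVFAt Y x) (hY' : DiffVFAt Y' x)
    (hX : DiffVFAt X x) (hZ : DiffVFAt Z x) :
    koszul (Y + Y') X Z x = koszul Y X Z x + koszul Y' X Z x := by
  simp only [koszul, dirDeriv_metric_add_right hX hY hY', dirDeriv_metric_add_left hY hY' hZ,
    bracket_add_right hY hY', bracket_add_left hY hY', dirDeriv_add_field, inner_add_left,
    inner_add_right, Pi.add_apply]
  ring

lemma koszul_smul {Y X Z : VF I M} {f : M → ℝ} {x : M} (hf : MDifferentiableAt I 𝓘(ℝ, ℝ) f x)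
    (hY : DiffVFAt Y x) (hX : DiffVFAt X x) (hZ : DiffVFAt Z x) :
    koszul (f • Y) X Z x =
      f x * koszul Y X Z x + 2 * (dirDeriv X f x * inner ℝ (Y x) (Z x)) := by
  simp only [koszul, dirDeriv_metric_smul_right hf hX hY, dirDeriv_metric_smul_left hf hY hZ,
    bracket_smul_right hf hY, bracket_smul_left hf hY, dirDeriv_smul_field, inner_add_left,
    inner_smul_left, inner_smul_right, Pi.smul_apply', conj_trivial]
  rw [real_inner_comm (Y x) (X x)]
  ring

open scoped Classical in
/-- The Koszul form of a vector field `Y`, a bilinear form on each tangent space; it is `0` at the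
points where `Y` is not differentiable. -/
def koszulForm (Y : VF I M) (x : M) :
    TangentSpace I x →L[ℝ] TangentSpace I x →L[ℝ] ℝ :=
  if hY : DiffVFAt Y x then
    TensorialAt.mkHom₂ (V := (TangentSpace I : M → Type _)) (V' := (TangentSpace I : M → Type _))
      (fun X Z ↦ koszul Y X Z x) x
      (fun _ hZ ↦ tensorialAt_koszul_left hY hZ) (fun _ hX ↦ tensorialAt_koszul_right hY hX)
  else 0

lemma koszulForm_apply {Y X Z : VF I M} {x : M} (hY : DiffVFAt Y x) (hX : DiffVFAt X x)
    (hZ : DiffVFAt Z x) : koszulForm Y x (X x) (Z x) = koszul Y X Z x := by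
  rw [koszulForm, dif_pos hY]
  exact TensorialAt.mkHom₂_apply _ _ hX hZ

lemma exists_diffVFAt {x : M} (v : TangentSpace I x) : ∃ V : VF I M, DiffVFAt V x ∧ V x = v :=
  ⟨FiberBundle.extend E v, FiberBundle.mdifferentiableAt_extend I E v,
    FiberBundle.extend_apply_self E v⟩

instance (x : M) : FiniteDimensional ℝ (TangentSpace I x) :=
  inferInstanceAs (FiniteDimensional ℝ E)

/-- The Levi-Civita derivative of a vector field, given by the Koszul formula. -/
def leviCivitaFun (Y : VF I M) (x : M) : TangentSpace I x →L[ℝ] TangentSpace I x :=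
  have : CompleteSpace (TangentSpace I x) := FiniteDimensional.complete ℝ _
  (1 / 2 : ℝ) • ((InnerProductSpace.toDual ℝ
    (TangentSpace I x)).symm.toContinuousLinearEquiv.toContinuousLinearMap ∘SL koszulForm Y x)

lemma inner_leviCivitaFun (Y : VF I M) (x : M) (v w : TangentSpace I x) :
    inner ℝ (leviCivitaFun Y x v) w = 1 / 2 * koszulForm Y x v w := by
  have : CompleteSpace (TangentSpace I x) := FiniteDimensional.complete ℝ _
  simp [leviCivitaFun, inner_smul_left]

lemma inner_leviCivitaFun_apply {Y X Z : VF I M} {x : M} (hY : DiffVFAt Y x) (hX : DiffVFAt X x)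
    (hZ : DiffVFAt Z x) :
    inner ℝ (leviCivitaFun Y x (X x)) (Z x) = 1 / 2 * koszul Y X Z x := by
  rw [inner_leviCivitaFun, koszulForm_apply hY hX hZ]

variable (I M) in
/-- The Levi-Civita connection. -/
def leviCivita : Connection I M where
  toFun := leviCivitaFun
  isCovariantDerivativeOnUniv :=
    { add := fun {Y Y' x} hY hY' _ ↦ by
        ext v
        obtain ⟨X, hX, rfl⟩ := exists_diffVFAt v
        refine ext_inner_right ℝ fun w ↦ ?_
        obtain ⟨Z, hZ, rfl⟩ := exists_diffVFAt w
        have hYY : DiffVFAt (Y + Y') x := mdifferentiableAt_add_section hY hY'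
        rw [add_apply, inner_add_left, inner_leviCivitaFun_apply hYY hX hZ,
          inner_leviCivitaFun_apply hY hX hZ, inner_leviCivitaFun_apply hY' hX hZ,
          koszul_add hY hY' hX hZ]
        ring
      leibniz := fun {Y f x} hY hf _ ↦ by
        ext v
        obtain ⟨X, hX, rfl⟩ := exists_diffVFAt v
        refine ext_inner_right ℝ fun w ↦ ?_
        obtain ⟨Z, hZ, rfl⟩ := exists_diffVFAt w
        have hfY : DiffVFAt (f • Y) x := MDifferentiableAt.smul_section hf hY
        rw [add_apply, inner_add_left, inner_leviCivitaFun_apply hfY hX hZ, koszul_smul hf hY hX hZ,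
          smul_apply, real_inner_smul_left, inner_leviCivitaFun_apply hY hX hZ,
          ContinuousLinearMap.smulRight_apply, real_inner_smul_left]
        simp only [dirDeriv]
        ring }

lemma inner_leviCivita {Y X Z : VF I M} {x : M} (hY : DiffVFAt Y x) (hX : DiffVFAt X x)
    (hZ : DiffVFAt Z x) :
    inner ℝ (leviCivita I M Y x (X x)) (Z x) = 1 / 2 * koszul Y X Z x :=
  inner_leviCivitaFun_apply hY hX hZ

lemma contMDiffAt_koszul {Y X Z : VF I M} {x : M} (hY : SmoothVFAt Y x) (hX : SmoothVFAt X x)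
    (hZ : SmoothVFAt Z x) : ContMDiffAt I 𝓘(ℝ, ℝ) ∞ (koszul Y X Z) x := by
  have h1 := contMDiffAt_dirDeriv (contMDiffAt_metric hY hZ) hX
  have h2 := contMDiffAt_dirDeriv (contMDiffAt_metric hX hZ) hY
  have h3 := contMDiffAt_dirDeriv (contMDiffAt_metric hX hY) hZ
  have h4 := contMDiffAt_metric (smoothVFAt_bracket hX hY) hZ
  have h5 := contMDiffAt_metric (smoothVFAt_bracket hX hZ) hY
  have h6 := contMDiffAt_metric (smoothVFAt_bracket hY hZ) hX
  exact ((((h1.add h2).sub h3).add h4).sub h5).sub h6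

lemma smoothConnection_leviCivita : SmoothConnection (leviCivita I M) where
  contMDiff :=
    { contMDiff := fun {Y} hY ↦ by
        intro x _
        have hY : SmoothVFAt Y x := by
          have := hY.contMDiffAt (x := x) Filter.univ_mem
          exact this.of_le (by simp)
        refine ContMDiffAt.contMDiffWithinAt ?_
        refine contMDiffAt_endField (φ := fun x ↦ leviCivita I M Y x) fun X hX ↦ ?_
        refine smoothVFAt_of_metric fun Z hZ ↦ ?_
        refine (contMDiffAt_const.mul (contMDiffAt_koszul hY hX hZ)
          (f := fun _ ↦ (1 / 2 : ℝ))).congr_of_eventuallyEq ?_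
        filter_upwards [hY.eventually, hX.eventually, hZ.eventually] with y hYy hXy hZy
        exact inner_leviCivita hYy hXy hZy }

variable (I M) in
theorem isLeviCivita_leviCivita : IsLeviCivita (leviCivita I M) where
  smooth := smoothConnection_leviCivita
  parallel := fun V W W' hV hW hW' x ↦ by
    have hV := hV.diffVFAt x
    have hW := hW.diffVFAt x
    have hW' := hW'.diffVFAt x
    simp only [metric, nabla]
    rw [inner_leviCivita hW hV hW', real_inner_comm, inner_leviCivita hW' hV hW]
    simp only [koszul, metric_comm W' W]
    rw [bracket_swap W' W]
    simp only [inner_neg_left]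
    ring
  torsion_free := fun x v w ↦ by
    obtain ⟨X, hX, rfl⟩ := exists_diffVFAt v
    obtain ⟨Y, hY, rfl⟩ := exists_diffVFAt w
    rw [CovariantDerivative.torsion_apply _ hX hY]
    refine ext_inner_right ℝ fun w ↦ ?_
    obtain ⟨Z, hZ, rfl⟩ := exists_diffVFAt w
    rw [inner_sub_left, inner_sub_left, inner_leviCivita hY hX hZ, inner_leviCivita hX hY hZ]
    simp only [koszul, metric_comm Y X, inner_zero_left]
    rw [bracket_swap Y X]
    simp only [inner_neg_left]
    ring

end Koszul

section SmoothFields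

set_option linter.unusedSectionVars false

variable {E : Type*} [NormedAddCommGroup E] [NormedSpace ℝ E] [FiniteDimensional ℝ E]
  [CompleteSpace E]
  {H : Type*} [TopologicalSpace H] {I : ModelWithCorners ℝ E H}
  {M : Type*} [TopologicalSpace M] [ChartedSpace H M] [IsManifold I ∞ M]

lemma SmoothVF.sub {V W : VF I M} (hV : SmoothVF V) (hW : SmoothVF W) : SmoothVF (V - W) :=
  ContMDiff.sub_section (V := (TangentSpace I : M → Type _)) hV hW

lemma SmoothVF.smul {V : VF I M} {f : M → ℝ} (hf : ContMDiff I 𝓘(ℝ, ℝ) ∞ f) (hV : SmoothVF V) :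
    SmoothVF (f • V) :=
  ContMDiff.smul_section (V := (TangentSpace I : M → Type _)) hf hV

lemma SmoothVF.bracket {V W : VF I M} (hV : SmoothVF V) (hW : SmoothVF W) :
    SmoothVF (bracket V W) :=
  fun x ↦ smoothVFAt_bracket (hV x) (hW x)

lemma SmoothEnd.smoothVFAt_app {φ : EndField I M} {V : VF I M} {x : M} (hφ : SmoothEnd φ)
    (hV : SmoothVFAt V x) : SmoothVFAt (app φ V) x :=
  ContMDiffAt.clm_bundle_apply (E₁ := (TangentSpace I : M → Type _))
    (E₂ := (TangentSpace I : M → Type _)) (ϕ := φ) (hφ x) hV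

lemma SmoothEnd.app {φ : EndField I M} {V : VF I M} (hφ : SmoothEnd φ) (hV : SmoothVF V) :
    SmoothVF (app φ V) :=
  fun x ↦ hφ.smoothVFAt_app (hV x)

lemma SmoothConnection.smoothEnd {D : Connection I M} (hD : SmoothConnection D) {W : VF I M}
    (hW : SmoothVF W) : SmoothEnd (fun x ↦ D W x) := by
  have h := hD.contMDiff.contMDiff (σ := W) (ContMDiff.contMDiffOn hW)
  exact contMDiffOn_univ.1 h

lemma connection_add (D : Connection I M) {V W : VF I M} (hV : SmoothVF V) (hW : SmoothVF W)
    (x : M) : D (V + W) x = D V x + D W x :=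
  D.isCovariantDerivativeOnUniv.add (hV.diffVFAt x) (hW.diffVFAt x)

lemma connection_smul (D : Connection I M) {W : VF I M} {f : M → ℝ}
    (hf : ContMDiff I 𝓘(ℝ, ℝ) ∞ f) (hW : SmoothVF W) (x : M) (v : TangentSpace I x) :
    D (f • W) x v = f x • D W x v + mvfderiv I f x v • W x := by
  rw [D.isCovariantDerivativeOnUniv.leibniz (hW.diffVFAt x)
    (hf.contMDiffAt.mdifferentiableAt (by simp))]
  rfl

variable [RiemannianBundle (fun x : M ↦ TangentSpace I x)]
  [IsContMDiffRiemannianBundle I ∞ E (fun x : M ↦ TangentSpace I x)]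

lemma SmoothVF.metric {V W : VF I M} (hV : SmoothVF V) (hW : SmoothVF W) :
    ContMDiff I 𝓘(ℝ, ℝ) ∞ (metric V W) :=
  fun x ↦ contMDiffAt_metric (hV x) (hW x)

variable [T2Space M]

lemma IsLeviCivita.mvfderiv_metric {LC : Connection I M} (hLC : IsLeviCivita LC) {V W : VF I M}
    (hV : SmoothVF V) (hW : SmoothVF W) (x : M) (v : TangentSpace I x) :
    mvfderiv I (ContactMetric.metric V W) x v =
      inner ℝ (LC V x v) (W x) + inner ℝ (V x) (LC W x v) := by
  obtain ⟨U, hU, rfl⟩ := exists_smoothVF v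
  have := hLC.parallel U V W hU hV hW x
  simp only [dirDeriv] at this
  rw [← sub_eq_zero, ← this, sub_sub]
  rfl

lemma IsLeviCivita.bracket_eq {LC : Connection I M} (hLC : IsLeviCivita LC) {V W : VF I M}
    (hV : SmoothVF V) (hW : SmoothVF W) (x : M) :
    ContactMetric.bracket V W x = LC W x (V x) - LC V x (W x) := by
  have := hLC.torsion_free x (V x) (W x)
  rw [LC.torsion_apply (hV.diffVFAt x) (hW.diffVFAt x)] at this
  exact (sub_eq_zero.1 this).symm

end SmoothFields

section Structure

set_option linter.unusedSectionVars false

variable {E : Type*} [NormedAddCommGroup E] [NormedSpace ℝ E] [FiniteDimensional ℝ E]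
  [CompleteSpace E]
  {H : Type*} [TopologicalSpace H] {I : ModelWithCorners ℝ E H}
  {M : Type*} [TopologicalSpace M] [ChartedSpace H M] [IsManifold I ∞ M] [T2Space M]
  [RiemannianBundle (fun x : M ↦ TangentSpace I x)]
  [IsContMDiffRiemannianBundle I ∞ E (fun x : M ↦ TangentSpace I x)]
  {n : ℕ} {φ : EndField I M} {ξ : VF I M} {η : OneForm I M}

namespace IsContactMetric

lemma eta_eq (hM : IsContactMetric n φ ξ η) {x : M} (v : TangentSpace I x) :
    η x v = inner ℝ v (ξ x) := by
  obtain ⟨U, hU, rfl⟩ := exists_smoothVF v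
  exact (hM.metric_xi U hU x).symm

lemma eta_eq_metric (hM : IsContactMetric n φ ξ η) (V : VF I M) :
    (fun x ↦ η x (V x)) = metric V ξ :=
  funext fun _ ↦ hM.eta_eq _

lemma inner_xi_eq (hM : IsContactMetric n φ ξ η) {x : M} (v : TangentSpace I x) :
    inner ℝ (ξ x) v = η x v := by
  rw [hM.eta_eq, real_inner_comm]

lemma contMDiff_eta (hM : IsContactMetric n φ ξ η) {V : VF I M} (hV : SmoothVF V) :
    ContMDiff I 𝓘(ℝ, ℝ) ∞ (fun x ↦ η x (V x)) := by
  rw [hM.eta_eq_metric]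
  exact hV.metric hM.smooth_xi

lemma eta_projD (hM : IsContactMetric n φ ξ η) {x : M} (v : TangentSpace I x) :
    η x (projD ξ η x v) = 0 := by
  simp [projD, hM.eta_xi]

lemma smoothHorizontal_projD (hM : IsContactMetric n φ ξ η) {V : VF I M} (hV : SmoothVF V) :
    SmoothHorizontal η (fun x ↦ projD ξ η x (V x)) :=
  ⟨hV.sub (SmoothVF.smul (hM.contMDiff_eta hV) hM.smooth_xi), fun _ ↦ hM.eta_projD _⟩

lemma exists_smoothHorizontal (hM : IsContactMetric n φ ξ η) {x : M} {v : TangentSpace I x}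
    (hv : η x v = 0) : ∃ Z : VF I M, SmoothHorizontal η Z ∧ Z x = v := by
  obtain ⟨V, hV, rfl⟩ := exists_smoothVF v
  exact ⟨_, hM.smoothHorizontal_projD hV, by simp [projD, hv]⟩

variable {LC : Connection I M}

/-- The covariant derivative of `η` along the Levi-Civita connection. -/
lemma mvfderiv_eta (hM : IsContactMetric n φ ξ η) (hLC : IsLeviCivita LC) {W : VF I M}
    (hW : SmoothVF W) (x : M) (v : TangentSpace I x) :
    mvfderiv I (fun y ↦ η y (W y)) x v = η x (LC W x v) + inner ℝ (W x) (LC ξ x v) := by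
  rw [hM.eta_eq_metric, hLC.mvfderiv_metric hW hM.smooth_xi, hM.eta_eq]

lemma eta_nabla_xi (hM : IsContactMetric n φ ξ η) (hLC : IsLeviCivita LC) {x : M}
    (v : TangentSpace I x) : η x (LC ξ x v) = 0 := by
  have h := hM.mvfderiv_eta hLC hM.smooth_xi x v
  rw [hM.inner_xi_eq, funext hM.eta_xi, mvfderiv_const] at h
  simp only [zero_apply] at h
  linarith

lemma dOne_eq (hM : IsContactMetric n φ ξ η) (hLC : IsLeviCivita LC) {V W : VF I M}
    (hV : SmoothVF V) (hW : SmoothVF W) (x : M) :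
    dOne η V W x = (inner ℝ (LC ξ x (V x)) (W x) - inner ℝ (LC ξ x (W x)) (V x)) / 2 := by
  rw [dOne, dirDeriv, dirDeriv, hM.mvfderiv_eta hLC hW, hM.mvfderiv_eta hLC hV,
    hLC.bracket_eq hV hW, map_sub, real_inner_comm, real_inner_comm (V x)]
  ring

lemma nabla_xi_xi (hM : IsContactMetric n φ ξ η) (hLC : IsLeviCivita LC) (x : M) :
    LC ξ x (ξ x) = 0 := by
  refine ext_inner_right ℝ fun w ↦ ?_
  obtain ⟨W, hW, rfl⟩ := exists_smoothVF w
  have h := hM.dOne_eq hLC hM.smooth_xi hW x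
  rw [hM.dEta_xi W hW, ← hM.eta_eq, hM.eta_nabla_xi hLC] at h
  rw [inner_zero_left]
  linarith

lemma inner_phi (hM : IsContactMetric n φ ξ η) (hLC : IsLeviCivita LC) {x : M}
    (v w : TangentSpace I x) :
    inner ℝ v (φ x w) = (inner ℝ (LC ξ x v) w - inner ℝ (LC ξ x w) v) / 2 := by
  obtain ⟨V, hV, rfl⟩ := exists_smoothVF v
  obtain ⟨W, hW, rfl⟩ := exists_smoothVF w
  rw [← hM.dOne_eq hLC hV hW, hM.dEta_eq V W hV hW]
  rfl

lemma inner_phi_swap (hM : IsContactMetric n φ ξ η) {x : M}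
    (v w : TangentSpace I x) : inner ℝ v (φ x w) = -inner ℝ (φ x v) w := by
  rw [real_inner_comm w, hM.inner_phi (isLeviCivita_leviCivita I M),
    hM.inner_phi (isLeviCivita_leviCivita I M)]
  ring

lemma phi_xi (hM : IsContactMetric n φ ξ η) (x : M) : φ x (ξ x) = 0 := by
  have hLC := isLeviCivita_leviCivita I M
  refine ext_inner_left ℝ fun w ↦ ?_
  rw [hM.inner_phi hLC, hM.nabla_xi_xi hLC, ← hM.eta_eq, hM.eta_nabla_xi hLC]
  simp

lemma eta_phi (hM : IsContactMetric n φ ξ η) {x : M} (v : TangentSpace I x) :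
    η x (φ x v) = 0 := by
  have := hM.inner_phi_swap v (ξ x)
  rw [hM.phi_xi, inner_zero_right, ← hM.eta_eq] at this
  linarith

end IsContactMetric

/-- The tensor `A(w, v) = -η(w) ∇̂_v ξ - η(v) ∇̂_w ξ + g(w, ∇̂_v ξ) ξ`. -/
def canonicalTensor (ξ : VF I M) (η : OneForm I M) (LC : Connection I M) (x : M) :
    TangentSpace I x →L[ℝ] TangentSpace I x →L[ℝ] TangentSpace I x :=
  (LinearMap.mk₂ ℝ (fun w v : TangentSpace I x ↦
      -(η x w • LC ξ x v) - η x v • LC ξ x w + (inner ℝ w (LC ξ x v) : ℝ) • ξ x)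
    (fun w w' v ↦ by simp only [map_add, inner_add_left]; module)
    (fun c w v ↦ by simp only [map_smul, real_inner_smul_left, smul_eq_mul]; module)
    (fun w v v' ↦ by simp only [map_add, inner_add_right]; module)
    (fun c w v ↦ by
      simp only [map_smul, real_inner_smul_right, smul_eq_mul]; module)).toContinuousBilinearMap

/-- The connection `∇̂ + A`. -/
def canonicalConnection (ξ : VF I M) (η : OneForm I M) (LC : Connection I M) : Connection I M :=
  LC.addOneForm (canonicalTensor ξ η LC)

lemma canonicalConnection_apply (ξ : VF I M) (η : OneForm I M) (LC : Connection I M)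
    (W : VF I M) (x : M) (v : TangentSpace I x) :
    canonicalConnection ξ η LC W x v = LC W x v - η x (W x) • LC ξ x v - η x v • LC ξ x (W x)
      + (inner ℝ (W x) (LC ξ x v) : ℝ) • ξ x := by
  change LC W x v + (-(η x (W x) • LC ξ x v) - η x v • LC ξ x (W x)
    + (inner ℝ (W x) (LC ξ x v) : ℝ) • ξ x) = _
  module

/-- Two connections for which `ξ` is parallel agree on smooth fields if they agree on horizontal
fields in the horizontal directions and in the direction of `ξ`. -/
lemma connection_ext (hM : IsContactMetric n φ ξ η) {D D' : Connection I M}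
    (h : ParallelVF D ξ) (h' : ParallelVF D' ξ)
    (hor : ∀ Z Z' : VF I M, SmoothHorizontal η Z → SmoothHorizontal η Z' → ∀ x,
      D Z' x (Z x) = D' Z' x (Z x))
    (reeb : ∀ Z : VF I M, SmoothHorizontal η Z → ∀ x, D Z x (ξ x) = D' Z x (ξ x))
    {W : VF I M} (hW : SmoothVF W) (x : M) (v : TangentSpace I x) : D W x v = D' W x v := by
  have hWD := hM.smoothHorizontal_projD hW
  set Z' : VF I M := fun x ↦ projD ξ η x (W x) with hZ'
  have hdec : W = Z' + (fun y ↦ η y (W y)) • ξ := by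
    ext y
    simp [hZ', projD]
  have key : ∀ w, D Z' x w = D' Z' x w := fun w ↦ by
    obtain ⟨Z, hZ, hZx⟩ := hM.exists_smoothHorizontal (hM.eta_projD w)
    have hw : w = Z x + η x w • ξ x := by simp [hZx, projD]
    rw [hw, map_add, map_add, map_smul, map_smul, hor Z Z' hZ hWD, reeb Z' hWD]
  have hξ := SmoothVF.smul (hM.contMDiff_eta hW) hM.smooth_xi
  rw [hdec, connection_add D hWD.1 hξ, connection_add D' hWD.1 hξ]
  simp only [add_apply]
  rw [connection_smul D (hM.contMDiff_eta hW) hM.smooth_xi,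
    connection_smul D' (hM.contMDiff_eta hW) hM.smooth_xi, key, h x, h' x]

theorem isCanonical_canonicalConnection (hM : IsContactMetric n φ ξ η) {LC : Connection I M}
    (hLC : IsLeviCivita LC) : IsCanonical ξ η LC (canonicalConnection ξ η LC) where
  smooth :=
    { contMDiff :=
      { contMDiff := fun {W} hW ↦ by
          rw [contMDiffOn_univ] at hW
          have hW : SmoothVF W := hW
          have hB := SmoothConnection.smoothEnd hLC.smooth hM.smooth_xi
          have hLW := SmoothConnection.smoothEnd hLC.smooth hW
          intro x _
          refine ContMDiffAt.contMDiffWithinAt ?_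
          refine contMDiffAt_endField (φ := fun x ↦ canonicalConnection ξ η LC W x) fun V hV ↦ ?_
          have hη : ∀ V : VF I M, SmoothVFAt V x →
              ContMDiffAt I 𝓘(ℝ, ℝ) ∞ (fun y ↦ η y (V y)) x := fun V hV ↦ by
            rw [hM.eta_eq_metric]
            exact contMDiffAt_metric hV (hM.smooth_xi x)
          have h1 := hLW.smoothVFAt_app hV
          have h2 := ContMDiffAt.smul_section (V := (TangentSpace I : M → Type _))
            (hη W (hW x)) (hB.smoothVFAt_app hV)
          have h3 := ContMDiffAt.smul_section (V := (TangentSpace I : M → Type _))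
            (hη V hV) (hB.smoothVFAt_app (hW x))
          have h4 := ContMDiffAt.smul_section (V := (TangentSpace I : M → Type _))
            (contMDiffAt_metric (hW x) (hB.smoothVFAt_app hV)) (hM.smooth_xi x)
          have h5 := ((ContMDiffAt.sub_section (V := (TangentSpace I : M → Type _)) h1
            h2).sub_section h3).add_section h4
          have : app (fun x ↦ canonicalConnection ξ η LC W x) V = _ :=
            funext fun y ↦ canonicalConnection_apply ξ η LC W y (V y)
          rw [this]
          exact h5 } }
  horizontal := fun Z Z' hZ hZ' x ↦ by
    have h := hM.mvfderiv_eta hLC hZ'.1 x (Z x)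
    rw [funext hZ'.2, mvfderiv_const] at h
    simp only [zero_apply] at h
    rw [nabla, canonicalConnection_apply, hZ.2, hZ'.2, projD, nabla,
      show inner ℝ (Z' x) (LC ξ x (Z x)) = -η x (LC Z' x (Z x)) by linarith]
    module
  reeb := fun Z hZ x ↦ by
    rw [nabla, canonicalConnection_apply, hZ.2, hM.nabla_xi_xi hLC,
      hLC.bracket_eq hM.smooth_xi hZ.1, hM.eta_xi]
    simp
  parallel := fun x ↦ by
    ext v
    rw [canonicalConnection_apply, hM.eta_xi, hM.nabla_xi_xi hLC, hM.inner_xi_eq,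
      hM.eta_nabla_xi hLC]
    simp

section Canonical

variable {LC D : Connection I M}

lemma IsCanonical.apply_eq (hD : IsCanonical ξ η LC D) (hM : IsContactMetric n φ ξ η)
    (hLC : IsLeviCivita LC) {W : VF I M} (hW : SmoothVF W) (x : M) (v : TangentSpace I x) :
    D W x v = LC W x v - η x (W x) • LC ξ x v - η x v • LC ξ x (W x)
      + (inner ℝ (W x) (LC ξ x v) : ℝ) • ξ x := by
  rw [← canonicalConnection_apply]
  have h := isCanonical_canonicalConnection hM hLC
  exact connection_ext hM hD.parallel h.parallel
    (fun Z Z' hZ hZ' x ↦ (hD.horizontal Z Z' hZ hZ' x).trans (h.horizontal Z Z' hZ hZ' x).symm)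
    (fun Z hZ x ↦ (hD.reeb Z hZ x).trans (h.reeb Z hZ x).symm) hW x v

lemma IsCanonical.eta_apply (hD : IsCanonical ξ η LC D) (hM : IsContactMetric n φ ξ η)
    (hLC : IsLeviCivita LC) {W : VF I M} (hW : SmoothVF W) (x : M) (v : TangentSpace I x) :
    η x (D W x v) = mvfderiv I (fun y ↦ η y (W y)) x v := by
  rw [hD.apply_eq hM hLC hW, hM.mvfderiv_eta hLC hW]
  simp [hM.eta_nabla_xi hLC, hM.eta_xi]

lemma IsCanonical.preservesD (hD : IsCanonical ξ η LC D) (hM : IsContactMetric n φ ξ η)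
    (hLC : IsLeviCivita LC) : PreservesD D η := fun V Z _ hZ x ↦ by
  rw [nabla, hD.eta_apply hM hLC hZ.1, funext hZ.2, mvfderiv_const]
  rfl

lemma IsCanonical.bracket_eq (hD : IsCanonical ξ η LC D) (hM : IsContactMetric n φ ξ η)
    (hLC : IsLeviCivita LC) {V W : VF I M} (hV : SmoothVF V) (hW : SmoothVF W) (x : M) :
    bracket V W x = D W x (V x) - D V x (W x)
      - (2 * (inner ℝ (V x) (φ x (W x)) : ℝ)) • ξ x := by
  rw [hLC.bracket_eq hV hW, hD.apply_eq hM hLC hW, hD.apply_eq hM hLC hV, hM.inner_phi hLC,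
    real_inner_comm (W x), real_inner_comm (V x)]
  module

lemma IsCanonical.hasContactTorsion (hD : IsCanonical ξ η LC D) (hM : IsContactMetric n φ ξ η)
    (hLC : IsLeviCivita LC) : HasContactTorsion D ξ η := fun V W hV hW x ↦ by
  rw [D.torsion_apply (hV.diffVFAt x) (hW.diffVFAt x), hM.dEta_eq V W hV hW]
  change _ - bracket V W x = _
  rw [hD.bracket_eq hM hLC hV hW, metric, app]
  module

/-- The covariant derivative of the metric along the canonical connection. -/
lemma IsCanonical.mvfderiv_metric (hD : IsCanonical ξ η LC D) (hM : IsContactMetric n φ ξ η)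
    (hLC : IsLeviCivita LC) {V W : VF I M} (hV : SmoothVF V) (hW : SmoothVF W) (x : M)
    (u : TangentSpace I x) :
    mvfderiv I (metric V W) x u =
      inner ℝ (D V x u) (W x) + inner ℝ (V x) (D W x u)
        + η x u * (inner ℝ (LC ξ x (V x)) (W x) + inner ℝ (V x) (LC ξ x (W x))) := by
  rw [hLC.mvfderiv_metric hV hW, hD.apply_eq hM hLC hV, hD.apply_eq hM hLC hW]
  simp only [inner_add_left, inner_add_right, inner_sub_left, inner_sub_right,
    real_inner_smul_left, real_inner_smul_right, hM.inner_xi_eq, ← hM.eta_eq]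
  rw [real_inner_comm (W x) (LC ξ x u)]
  ring

lemma IsCanonical.metricAlongD (hD : IsCanonical ξ η LC D) (hM : IsContactMetric n φ ξ η)
    (hLC : IsLeviCivita LC) : MetricAlongD D η := fun Z Z' Z'' hZ hZ' hZ'' x ↦ by
  rw [dirDeriv, hD.mvfderiv_metric hM hLC hZ'.1 hZ''.1, hZ.2]
  simp only [metric, nabla]
  ring

/-- The Reeb field is Killing if and only if `∇̂ξ` is skew-symmetric. -/
lemma isKContact_iff (hM : IsContactMetric n φ ξ η) (hLC : IsLeviCivita LC) :
    IsKContact ξ ↔ ∀ x (v w : TangentSpace I x),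
      inner ℝ (LC ξ x v) w + inner ℝ v (LC ξ x w) = 0 := by
  have key : ∀ V W : VF I M, SmoothVF V → SmoothVF W → ∀ x,
      dirDeriv ξ (metric V W) x - metric (bracket ξ V) W x - metric V (bracket ξ W) x =
        inner ℝ (LC ξ x (V x)) (W x) + inner ℝ (V x) (LC ξ x (W x)) := fun V W hV hW x ↦ by
    rw [dirDeriv, hLC.mvfderiv_metric hV hW]
    simp only [metric]
    rw [hLC.bracket_eq hM.smooth_xi hV, hLC.bracket_eq hM.smooth_xi hW, inner_sub_left,
      inner_sub_right]
    ring
  constructor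
  · intro h x v w
    obtain ⟨V, hV, rfl⟩ := exists_smoothVF v
    obtain ⟨W, hW, rfl⟩ := exists_smoothVF w
    rw [← key V W hV hW]
    exact h V W hV hW x
  · intro h V W hV hW x
    rw [key V W hV hW]
    exact h x _ _

lemma IsCanonical.parallelMetric_iff (hD : IsCanonical ξ η LC D) (hM : IsContactMetric n φ ξ η)
    (hLC : IsLeviCivita LC) :
    ParallelMetric D ↔ ∀ x (v w : TangentSpace I x),
      inner ℝ (LC ξ x v) w + inner ℝ v (LC ξ x w) = 0 := by
  constructor
  · intro h x v w
    obtain ⟨V, hV, rfl⟩ := exists_smoothVF v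
    obtain ⟨W, hW, rfl⟩ := exists_smoothVF w
    have := h ξ V W hM.smooth_xi hV hW x
    rw [dirDeriv, hD.mvfderiv_metric hM hLC hV hW, hM.eta_xi] at this
    simp only [metric, nabla] at this
    linarith
  · intro h U V W _ hV hW x
    rw [dirDeriv, hD.mvfderiv_metric hM hLC hV hW, h]
    simp only [metric, nabla]
    ring

/-- The uniqueness of the canonical connection. -/
theorem eq_of_contactTorsion (hM : IsContactMetric n φ ξ η) {D D' : Connection I M}
    (h1 : PreservesD D η) (h2 : ParallelVF D ξ) (h3 : HasContactTorsion D ξ η)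
    (h4 : MetricAlongD D η) (h1' : PreservesD D' η) (h2' : ParallelVF D' ξ)
    (h3' : HasContactTorsion D' ξ η) (h4' : MetricAlongD D' η) {W : VF I M} (hW : SmoothVF W)
    (x : M) (v : TangentSpace I x) : D' W x v = D W x v := by
  have tor : ∀ {V W : VF I M}, SmoothVF V → SmoothVF W → ∀ x,
      D' W x (V x) - D W x (V x) = D' V x (W x) - D V x (W x) := fun {V W} hV hW x ↦ by
    have a := h3 V W hV hW x
    have b := h3' V W hV hW x
    rw [D.torsion_apply (hV.diffVFAt x) (hW.diffVFAt x), ← b,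
      D'.torsion_apply (hV.diffVFAt x) (hW.diffVFAt x)] at a
    rw [sub_left_inj] at a
    rw [sub_eq_sub_iff_add_eq_add] at a ⊢
    rw [← sub_eq_zero] at a ⊢
    rw [← neg_eq_zero, ← a]
    abel
  refine connection_ext hM h2' h2 (fun X Y hX hY x ↦ ?_) (fun Z hZ x ↦ ?_) hW x v
  · have met : ∀ {X Y Z : VF I M}, SmoothHorizontal η X → SmoothHorizontal η Y →
        SmoothHorizontal η Z → inner ℝ (D' Y x (X x) - D Y x (X x)) (Z x) =
          -inner ℝ (D' Z x (X x) - D Z x (X x)) (Y x) := fun {X Y Z} hX hY hZ ↦ by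
      have a := h4 X Y Z hX hY hZ x
      have b := h4' X Y Z hX hY hZ x
      simp only [metric, nabla] at a b
      rw [inner_sub_left, inner_sub_left, real_inner_comm (Y x), real_inner_comm (Y x)]
      linarith
    have hz : η x (D' Y x (X x) - D Y x (X x)) = 0 := by
      have a := h1 X Y hX.1 hY x
      have b := h1' X Y hX.1 hY x
      rw [nabla] at a b
      rw [map_sub, a, b, sub_zero]
    obtain ⟨Z, hZ, hZx⟩ := hM.exists_smoothHorizontal hz
    rw [← sub_eq_zero, ← inner_self_eq_zero (𝕜 := ℝ)]
    nth_rw 2 [← hZx]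
    have e1 := met hX hY hZ
    have e2 := met hY hX hZ
    have e3 := met hZ hX hY
    rw [tor hY.1 hX.1] at e2
    rw [tor hZ.1 hX.1] at e3
    rw [tor hZ.1 hY.1] at e3
    linarith
  · have := tor hZ.1 hM.smooth_xi x
    rw [h2 x, h2' x] at this
    simpa [sub_eq_zero] using this.symm

end Canonical

end Structure

section Sasakian

set_option linter.unusedSectionVars false

variable {E : Type*} [NormedAddCommGroup E] [NormedSpace ℝ E] [FiniteDimensional ℝ E]
  [CompleteSpace E]
  {H : Type*} [TopologicalSpace H] {I : ModelWithCorners ℝ E H}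
  {M : Type*} [TopologicalSpace M] [ChartedSpace H M] [IsManifold I ∞ M]

/-- The covariant derivative `(∇_v φ) W` of an endomorphism field. -/
def covEnd (D : Connection I M) (φ : EndField I M) (W : VF I M) (x : M) :
    TangentSpace I x →L[ℝ] TangentSpace I x :=
  D (app φ W) x - φ x ∘L D W x

lemma covEnd_apply (D : Connection I M) (φ : EndField I M) (W : VF I M) (x : M)
    (v : TangentSpace I x) : covEnd D φ W x v = D (app φ W) x v - φ x (D W x v) := rfl

variable [T2Space M]

lemma parallelEnd_iff {D : Connection I M} {φ : EndField I M} :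
    ParallelEnd D φ ↔ ∀ W : VF I M, SmoothVF W → ∀ x v, covEnd D φ W x v = 0 := by
  refine ⟨fun h W hW x v ↦ ?_, fun h V W _ hW x ↦ h W hW x (V x)⟩
  obtain ⟨V, hV, rfl⟩ := exists_smoothVF v
  exact h V W hV hW x

/-- The Jacobi identity. -/
lemma bracket_jacobi {X Y Z : VF I M} (hX : SmoothVF X) (hY : SmoothVF Y) (hZ : SmoothVF Z)
    (x : M) :
    bracket X (bracket Y Z) x - bracket Y (bracket X Z) x + bracket Z (bracket X Y) x = 0 := by
  have h2 : minSmoothness ℝ 2 ≤ (∞ : ℕ∞ω) := by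
    rw [minSmoothness_of_isRCLikeNormedField]
    exact ENat.LEInfty.out
  have h3 : IsManifold I (minSmoothness ℝ 3) M := by
    rw [minSmoothness_of_isRCLikeNormedField]
    exact IsManifold.of_le (n := ∞) ENat.LEInfty.out
  have h := VectorField.leibniz_identity_mlieBracket_apply (I := I)
    ((hX.smoothVFAt x).of_le h2) ((hY.smoothVFAt x).of_le h2) ((hZ.smoothVFAt x).of_le h2)
  rw [bracket, bracket, h, bracket_swap Z]
  abel

variable [RiemannianBundle (fun x : M ↦ TangentSpace I x)]
  [IsContMDiffRiemannianBundle I ∞ E (fun x : M ↦ TangentSpace I x)]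
  {n : ℕ} {φ : EndField I M} {ξ : VF I M} {η : OneForm I M}

lemma IsContactMetric.inner_phi_left (hM : IsContactMetric n φ ξ η) {x : M}
    (v w : TangentSpace I x) : inner ℝ (φ x v) w = -inner ℝ v (φ x w) := by
  rw [hM.inner_phi_swap, neg_neg]

/-- `dη` is closed, for fields on which `η` is constant. -/
lemma IsContactMetric.closed (hM : IsContactMetric n φ ξ η) {X Y Z : VF I M} {a b c : ℝ}
    (hX : SmoothVF X) (hY : SmoothVF Y) (hZ : SmoothVF Z) (ha : ∀ x, η x (X x) = a)
    (hb : ∀ x, η x (Y x) = b) (hc : ∀ x, η x (Z x) = c) (x : M) :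
    (mvfderiv I (metric Y (app φ Z)) x (X x) + inner ℝ (X x) (φ x (bracket Y Z x)))
      - (mvfderiv I (metric X (app φ Z)) x (Y x) + inner ℝ (Y x) (φ x (bracket X Z x)))
      + (mvfderiv I (metric X (app φ Y)) x (Z x) + inner ℝ (Z x) (φ x (bracket X Y x))) = 0 := by
  have key : ∀ {X Y Z : VF I M} {a b c : ℝ}, SmoothVF X → SmoothVF Y → SmoothVF Z →
      (∀ x, η x (X x) = a) → (∀ x, η x (Y x) = b) → (∀ x, η x (Z x) = c) →
      mvfderiv I (metric Y (app φ Z)) x (X x) + inner ℝ (X x) (φ x (bracket Y Z x)) =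
        -η x (bracket X (bracket Y Z) x) / 2 := fun {X Y Z a b c} hX hY hZ ha hb hc ↦ by
    have h1 : (fun y ↦ η y (bracket Y Z y)) = (fun _ ↦ (-2 : ℝ)) * metric Y (app φ Z) := by
      ext y
      have h := hM.dEta_eq Y Z hY hZ y
      rw [dOne, dirDeriv, dirDeriv, funext hb, funext hc, mvfderiv_const, mvfderiv_const] at h
      simp only [zero_apply] at h
      simp only [Pi.mul_apply]
      linarith
    have h2 := hM.dEta_eq X (bracket Y Z) hX (hY.bracket hZ) x
    have hm : MDifferentiableAt I 𝓘(ℝ, ℝ) (metric Y (app φ Z)) x :=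
      mdifferentiableAt_metric (hY.diffVFAt x) ((hM.smooth_phi.app hZ).diffVFAt x)
    rw [dOne, dirDeriv, dirDeriv, h1, funext ha, mvfderiv_const,
      mvfderiv_mul mdifferentiableAt_const hm, mvfderiv_const] at h2
    simp only [zero_apply, smul_apply, smul_zero, smul_eq_mul, metric, app, add_zero] at h2
    linarith
  rw [key hX hY hZ ha hb hc, key hY hX hZ hb ha hc, key hZ hX hY hc ha hb]
  have h := congrArg (η x) (bracket_jacobi hX hY hZ x)
  rw [map_add, map_sub, map_zero] at h
  linarith

namespace IsCanonical

variable {LC D : Connection I M}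

lemma covEnd_xi (hD : IsCanonical ξ η LC D) (hM : IsContactMetric n φ ξ η) (x : M)
    (v : TangentSpace I x) : covEnd D φ ξ x v = 0 := by
  have h0 : app φ ξ = 0 := funext hM.phi_xi
  rw [covEnd_apply, h0, D.zero, hD.parallel x]
  simp

lemma eta_covEnd (hD : IsCanonical ξ η LC D) (hM : IsContactMetric n φ ξ η)
    (hLC : IsLeviCivita LC) {W : VF I M} (hW : SmoothVF W) (x : M) (v : TangentSpace I x) :
    η x (covEnd D φ W x v) = 0 := by
  have h0 : (fun y ↦ η y (app φ W y)) = fun _ ↦ 0 := funext fun y ↦ hM.eta_phi _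
  rw [covEnd_apply, map_sub, hM.eta_phi, hD.eta_apply hM hLC (hM.smooth_phi.app hW), h0,
    mvfderiv_const]
  simp

lemma normality_eq (hD : IsCanonical ξ η LC D) (hM : IsContactMetric n φ ξ η)
    (hLC : IsLeviCivita LC) {V W : VF I M} (hV : SmoothVF V) (hW : SmoothVF W) (x : M) :
    φ x (φ x (bracket V W x)) + bracket (app φ V) (app φ W) x
      - φ x (bracket (app φ V) W x) - φ x (bracket V (app φ W) x)
      + (2 * dOne η V W x) • ξ x =
    covEnd D φ W x (φ x (V x)) - covEnd D φ V x (φ x (W x))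
      - φ x (covEnd D φ W x (V x)) + φ x (covEnd D φ V x (W x)) := by
  have hφV := hM.smooth_phi.app hV
  have hφW := hM.smooth_phi.app hW
  have e : (inner ℝ (φ x (V x)) (φ x (φ x (W x))) : ℝ) = inner ℝ (V x) (φ x (W x)) := by
    rw [hM.phi_sq, inner_add_right, inner_neg_right, real_inner_smul_right, ← hM.eta_eq,
      hM.eta_phi, hM.inner_phi_left]
    ring
  rw [hD.bracket_eq hM hLC hV hW, hD.bracket_eq hM hLC hφV hφW, hD.bracket_eq hM hLC hφV hW,
    hD.bracket_eq hM hLC hV hφW, hM.dEta_eq V W hV hW]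
  simp only [covEnd_apply, map_sub, map_smul, hM.phi_xi, smul_zero, sub_zero, metric]
  simp only [app, e]
  abel

lemma covEnd_skew (hD : IsCanonical ξ η LC D) (hM : IsContactMetric n φ ξ η)
    (hLC : IsLeviCivita LC) {Y Z : VF I M} (hY : SmoothVF Y) (hZ : SmoothVF Z) {x : M}
    {v : TangentSpace I x} (hv : η x v = 0) :
    inner ℝ (covEnd D φ Y x v) (Z x) = -inner ℝ (covEnd D φ Z x v) (Y x) := by
  have hφY := hM.smooth_phi.app hY
  have hφZ := hM.smooth_phi.app hZ
  have h0 : metric (app φ Y) Z = -metric Y (app φ Z) :=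
    funext fun y ↦ hM.inner_phi_left _ _
  have h1 := hD.mvfderiv_metric hM hLC hφY hZ x v
  rw [h0, mvfderiv_neg, neg_apply, hD.mvfderiv_metric hM hLC hY hφZ, hv] at h1
  rw [covEnd_apply, covEnd_apply, inner_sub_left, inner_sub_left, hM.inner_phi_left,
    hM.inner_phi_left, real_inner_comm (Y x) (D (app φ Z) x v)]
  simp only [app, hM.inner_phi_left] at h1
  rw [hM.inner_phi_swap (Y x) (D Z x v), real_inner_comm (D Z x v) (φ x (Y x))] at h1
  linarith

/-- The closedness of `dη` in terms of the canonical connection. -/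
lemma covEnd_cyclic (hD : IsCanonical ξ η LC D) (hM : IsContactMetric n φ ξ η)
    (hLC : IsLeviCivita LC) {X Y Z : VF I M} {a b c : ℝ}
    (hX : SmoothVF X) (hY : SmoothVF Y) (hZ : SmoothVF Z) (ha : ∀ x, η x (X x) = a)
    (hb : ∀ x, η x (Y x) = b) (hc : ∀ x, η x (Z x) = c) (x : M) :
    (inner ℝ (Y x) (covEnd D φ Z x (X x)) + a * (inner ℝ (LC ξ x (Y x)) (φ x (Z x))
        + inner ℝ (Y x) (LC ξ x (φ x (Z x)))))
      - (inner ℝ (X x) (covEnd D φ Z x (Y x)) + b * (inner ℝ (LC ξ x (X x)) (φ x (Z x))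
        + inner ℝ (X x) (LC ξ x (φ x (Z x)))))
      + (inner ℝ (X x) (covEnd D φ Y x (Z x)) + c * (inner ℝ (LC ξ x (X x)) (φ x (Y x))
        + inner ℝ (X x) (LC ξ x (φ x (Y x))))) = 0 := by
  have h := hM.closed hX hY hZ ha hb hc x
  have hφY := hM.smooth_phi.app hY
  have hφZ := hM.smooth_phi.app hZ
  rw [hD.mvfderiv_metric hM hLC hY hφZ, hD.mvfderiv_metric hM hLC hX hφZ,
    hD.mvfderiv_metric hM hLC hX hφY, hD.bracket_eq hM hLC hY hZ, hD.bracket_eq hM hLC hX hZ,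
    hD.bracket_eq hM hLC hX hY, ha, hb, hc] at h
  simp only [map_sub, map_smul, hM.phi_xi, smul_zero, sub_zero, inner_sub_right] at h
  simp only [covEnd_apply, inner_sub_right]
  simp only [app] at h ⊢
  have s : ∀ u w : TangentSpace I x, (inner ℝ u (φ x w) : ℝ) = -inner ℝ w (φ x u) := fun u w ↦ by
    rw [real_inner_comm, hM.inner_phi_left]
  rw [s (X x) (D Z x (Y x)), s (Y x) (D Z x (X x)), s (X x) (D Y x (Z x))] at h ⊢
  rw [s (Y x) (D X x (Z x)), s (Z x) (D Y x (X x)), s (Z x) (D X x (Y x))] at h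
  linarith

lemma covEnd_eq_zero_of_horizontal (hD : IsCanonical ξ η LC D) (hM : IsContactMetric n φ ξ η)
    (h : ∀ Z W : VF I M, SmoothHorizontal η Z → SmoothHorizontal η W → ∀ x,
      covEnd D φ W x (Z x) = 0)
    (hξ : ∀ W : VF I M, SmoothVF W → ∀ x, covEnd D φ W x (ξ x) = 0)
    {W : VF I M} (hW : SmoothVF W) (x : M) (v : TangentSpace I x) : covEnd D φ W x v = 0 := by
  have hWD := hM.smoothHorizontal_projD hW
  set W' : VF I M := fun x ↦ projD ξ η x (W x) with hW'
  have hdec : W = W' + (fun y ↦ η y (W y)) • ξ := by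
    ext y
    simp [hW', projD]
  have hφ : app φ W = app φ W' := by
    ext y
    simp [app, hW', projD, hM.phi_xi]
  have e : covEnd D φ W x v = covEnd D φ W' x v := by
    rw [covEnd_apply, covEnd_apply, hφ]
    conv_lhs => rw [hdec]
    rw [connection_add D hWD.1 (SmoothVF.smul (hM.contMDiff_eta hW) hM.smooth_xi), add_apply,
      connection_smul D (hM.contMDiff_eta hW) hM.smooth_xi, hD.parallel x]
    simp [hM.phi_xi]
  obtain ⟨Z, hZ, hZx⟩ := hM.exists_smoothHorizontal (hM.eta_projD v)
  have hv : v = Z x + η x v • ξ x := by simp [hZx, projD]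
  rw [e, hv, map_add, map_smul, h Z W' hZ hWD, hξ W' hWD.1]
  simp

lemma covEnd_xi_right_of_isNormal (hD : IsCanonical ξ η LC D) (hM : IsContactMetric n φ ξ η)
    (hLC : IsLeviCivita LC) (hN : IsNormal φ ξ η) {W : VF I M} (hW : SmoothVF W) (x : M) :
    covEnd D φ W x (ξ x) = 0 := by
  have h := hD.normality_eq hM hLC hM.smooth_xi hW x
  rw [hN ξ W hM.smooth_xi hW x, hM.phi_xi, hD.covEnd_xi hM, hD.covEnd_xi hM] at h
  simp only [map_zero, sub_zero, add_zero, zero_sub] at h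
  have h2 := hM.phi_sq x (covEnd D φ W x (ξ x))
  rw [hD.eta_covEnd hM hLC hW, neg_eq_zero.1 h.symm] at h2
  simpa using h2.symm

lemma smoothHorizontal_app (hM : IsContactMetric n φ ξ η) {Z : VF I M} (hZ : SmoothVF Z) :
    SmoothHorizontal η (app φ Z) :=
  ⟨hM.smooth_phi.app hZ, fun _ ↦ hM.eta_phi _⟩

lemma covEnd_horizontal_of_isNormal (hD : IsCanonical ξ η LC D) (hM : IsContactMetric n φ ξ η)
    (hLC : IsLeviCivita LC) (hN : IsNormal φ ξ η) {Z W : VF I M} (hZ : SmoothHorizontal η Z)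
    (hW : SmoothHorizontal η W) (x : M) : covEnd D φ W x (Z x) = 0 := by
  have skew : ∀ {X Y Z : VF I M}, SmoothHorizontal η X → SmoothHorizontal η Y →
      SmoothHorizontal η Z → inner ℝ (covEnd D φ Y x (X x)) (Z x) =
        -inner ℝ (covEnd D φ Z x (X x)) (Y x) := fun hX hY hZ ↦
    hD.covEnd_skew hM hLC hY.1 hZ.1 (hX.2 x)
  have cyc : ∀ {X Y Z : VF I M}, SmoothHorizontal η X → SmoothHorizontal η Y →
      SmoothHorizontal η Z → inner ℝ (covEnd D φ Y x (X x)) (Z x) +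
        inner ℝ (covEnd D φ Z x (Y x)) (X x) + inner ℝ (covEnd D φ X x (Z x)) (Y x) = 0 :=
    fun {X Y Z} hX hY hZ ↦ by
      have h := hD.covEnd_cyclic hM hLC hX.1 hY.1 hZ.1 hX.2 hY.2 hZ.2 x
      rw [real_inner_comm (covEnd D φ Z x (X x)) (Y x),
        real_inner_comm (covEnd D φ Z x (Y x)) (X x),
        real_inner_comm (covEnd D φ Y x (Z x)) (X x)] at h
      linarith [skew hX hY hZ, skew hZ hX hY, skew hY hZ hX]
  have nrm : ∀ {X Y Z : VF I M}, SmoothHorizontal η X → SmoothHorizontal η Y →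
      SmoothHorizontal η Z → inner ℝ (covEnd D φ Y x (app φ X x)) (Z x) -
        inner ℝ (covEnd D φ X x (app φ Y x)) (Z x) +
        inner ℝ (covEnd D φ Y x (X x)) (app φ Z x) -
        inner ℝ (covEnd D φ X x (Y x)) (app φ Z x) = 0 := fun {X Y Z} hX hY hZ ↦ by
    have h := hD.normality_eq hM hLC hX.1 hY.1 x
    rw [hN X Y hX.1 hY.1 x] at h
    have h' := congrArg (fun u ↦ (inner ℝ u (Z x) : ℝ)) h
    simp only [inner_zero_left, inner_add_left, inner_sub_left, hM.inner_phi_left] at h'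
    simp only [app]
    linarith
  have step : ∀ {X Y Z : VF I M}, SmoothHorizontal η X → SmoothHorizontal η Y →
      SmoothHorizontal η Z → inner ℝ (covEnd D φ Y x (app φ X x)) (Z x) +
        inner ℝ (covEnd D φ Z x (app φ Y x)) (X x) -
        inner ℝ (covEnd D φ X x (app φ Z x)) (Y x) = 0 := fun {X Y Z} hX hY hZ ↦ by
    have hφY := smoothHorizontal_app hM hY.1
    have hφZ := smoothHorizontal_app hM hZ.1
    have h1 := nrm hX hY hZ
    have h2 := cyc hX hY hφZ
    have h3 := skew hY hφZ hX
    have h4 := skew hφY hX hZ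
    linarith
  have hη : η x (covEnd D φ W x (Z x)) = 0 := hD.eta_covEnd hM hLC hW.1 x _
  obtain ⟨U, hU, hUx⟩ := hM.exists_smoothHorizontal hη
  have hφZ := smoothHorizontal_app hM hZ.1
  have e1 := step hφZ hW hU
  have e2 := step hU hφZ hW
  have e3 : app φ (app φ Z) x = -Z x := by simp [app, hM.phi_sq, hZ.2]
  rw [e3, map_neg, inner_neg_left] at e1 e2
  rw [← inner_self_eq_zero (𝕜 := ℝ)]
  nth_rw 2 [← hUx]
  linarith

theorem isNormal_iff (hD : IsCanonical ξ η LC D) (hM : IsContactMetric n φ ξ η)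
    (hLC : IsLeviCivita LC) : IsNormal φ ξ η ↔ ParallelEnd D φ := by
  rw [parallelEnd_iff]
  constructor
  · intro hN W hW x v
    exact hD.covEnd_eq_zero_of_horizontal hM
      (fun Z W hZ hW x ↦ hD.covEnd_horizontal_of_isNormal hM hLC hN hZ hW x)
      (fun W hW x ↦ hD.covEnd_xi_right_of_isNormal hM hLC hN hW x) hW x v
  · intro h V W hV hW x
    rw [hD.normality_eq hM hLC hV hW]
    simp [h V hV, h W hW]

/-- On a Sasakian manifold, the Reeb field is Killing. -/
lemma nabla_xi_skew_of_isNormal (hD : IsCanonical ξ η LC D) (hM : IsContactMetric n φ ξ η)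
    (hLC : IsLeviCivita LC) (hN : IsNormal φ ξ η) (x : M) (v w : TangentSpace I x) :
    inner ℝ (LC ξ x v) w + inner ℝ v (LC ξ x w) = 0 := by
  have hor : ∀ v w : TangentSpace I x, η x v = 0 → η x w = 0 →
      inner ℝ (LC ξ x v) (φ x w) + inner ℝ v (LC ξ x (φ x w)) = 0 := fun v w hv hw ↦ by
    obtain ⟨V, hV, rfl⟩ := hM.exists_smoothHorizontal hv
    obtain ⟨W, hW, rfl⟩ := hM.exists_smoothHorizontal hw
    have h := hD.covEnd_cyclic hM hLC hM.smooth_xi hV.1 hW.1 hM.eta_xi hV.2 hW.2 x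
    simp only [hD.covEnd_xi_right_of_isNormal hM hLC hN hW.1, hM.inner_xi_eq,
      hD.eta_covEnd hM hLC hW.1, hD.eta_covEnd hM hLC hV.1, inner_zero_right] at h
    linarith
  obtain ⟨v', hv', hv⟩ : ∃ v', η x v' = 0 ∧ v = v' + η x v • ξ x :=
    ⟨projD ξ η x v, hM.eta_projD v, by simp [projD]⟩
  obtain ⟨w', hw', hw⟩ : ∃ w', η x w' = 0 ∧ w = φ x w' + η x w • ξ x :=
    ⟨-φ x w, by rw [map_neg, hM.eta_phi, neg_zero], by simp [hM.phi_sq]⟩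
  have h := hor v' w' hv' hw'
  rw [hv, hw]
  simp only [map_add, map_smul, hM.nabla_xi_xi hLC, smul_zero, add_zero, inner_add_left,
    inner_add_right, real_inner_smul_left, real_inner_smul_right, ← hM.eta_eq, hM.inner_xi_eq,
    hM.eta_nabla_xi hLC]
  linarith

theorem nabla_eq_tanakaWebster (hD : IsCanonical ξ η LC D) (hM : IsContactMetric n φ ξ η)
    (hLC : IsLeviCivita LC) (hN : IsNormal φ ξ η) {V W : VF I M} (hV : SmoothVF V)
    (hW : SmoothVF W) : nabla D V W = tanakaWebster φ ξ η LC V W := by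
  have hB : ∀ x (v : TangentSpace I x), LC ξ x v = -φ x v := fun x v ↦ by
    refine ext_inner_right ℝ fun w ↦ ?_
    have h1 := hM.inner_phi hLC v w
    have h2 := hD.nabla_xi_skew_of_isNormal hM hLC hN x v w
    rw [inner_neg_left, hM.inner_phi_left, h1]
    rw [real_inner_comm (LC ξ x w) v] at h2
    linarith
  have hh : hField φ ξ V = 0 := by
    ext x
    have hφV := hM.smooth_phi.app hV
    have h := hD.covEnd_xi_right_of_isNormal hM hLC hN hV x
    rw [covEnd_apply] at h
    rw [hField, hD.bracket_eq hM hLC hM.smooth_xi hφV, hD.bracket_eq hM hLC hM.smooth_xi hV,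
      hM.inner_xi_eq, hM.inner_xi_eq, hM.eta_phi, hM.eta_phi, hD.parallel x]
    simp [h]
  ext x
  rw [tanakaWebster, hh, add_zero, hM.dEta_eq V W hV hW, nabla, hD.apply_eq hM hLC hW, hB, hB,
    inner_neg_right, nabla, metric, app]
  rw [real_inner_comm (φ x (V x)) (W x), hM.inner_phi_left]
  simp only [Pi.zero_apply, map_zero]
  module

end IsCanonical

end Sasakian

end ContactMetric

end

open ContactMetric in
theorem theorem4p3 (n : ℕ) {M : Type*} [TopologicalSpace M] [T2Space M]
    [SecondCountableTopology M]
    [ChartedSpace (EuclideanSpace ℝ (Fin (2 * n + 1))) M] [IsManifold (𝓡 (2 * n + 1)) ∞ M]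
    [RiemannianBundle (fun x : M ↦ TangentSpace (𝓡 (2 * n + 1)) x)]
    [IsContMDiffRiemannianBundle (𝓡 (2 * n + 1)) ∞ (EuclideanSpace ℝ (Fin (2 * n + 1)))
      (fun x : M ↦ TangentSpace (𝓡 (2 * n + 1)) x)]
    (φ : EndField (𝓡 (2 * n + 1)) M) (ξ : VF (𝓡 (2 * n + 1)) M)
    (η : OneForm (𝓡 (2 * n + 1)) M) (hM : IsContactMetric n φ ξ η) :
    (∃ LC : Connection (𝓡 (2 * n + 1)) M, IsLeviCivita LC) ∧
    ∀ LC : Connection (𝓡 (2 * n + 1)) M, IsLeviCivita LC →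
      (∃ D : Connection (𝓡 (2 * n + 1)) M, IsCanonical ξ η LC D) ∧
      ∀ D : Connection (𝓡 (2 * n + 1)) M, IsCanonical ξ η LC D →
        (PreservesD D η ∧ ParallelVF D ξ ∧ HasContactTorsion D ξ η ∧ MetricAlongD D η) ∧
        (∀ D' : Connection (𝓡 (2 * n + 1)) M, SmoothConnection D' → PreservesD D' η →
          ParallelVF D' ξ → HasContactTorsion D' ξ η → MetricAlongD D' η →
          ∀ V W : VF (𝓡 (2 * n + 1)) M, SmoothVF V → SmoothVF W → nabla D' V W = nabla D V W) ∧
        (IsKContact ξ ↔ ParallelMetric D) ∧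
        (IsNormal φ ξ η ↔ ParallelEnd D φ) ∧
        (IsNormal φ ξ η → ∀ V W : VF (𝓡 (2 * n + 1)) M, SmoothVF V → SmoothVF W →
          nabla D V W = tanakaWebster φ ξ η LC V W) := by
  refine ⟨⟨_, isLeviCivita_leviCivita _ M⟩, fun LC hLC ↦
    ⟨⟨_, isCanonical_canonicalConnection hM hLC⟩, fun D hD ↦ ?_⟩⟩
  refine ⟨⟨hD.preservesD hM hLC, hD.parallel, hD.hasContactTorsion hM hLC,
    hD.metricAlongD hM hLC⟩, fun D' _ h1 h2 h3 h4 V W _ hW ↦ ?_, ?_, hD.isNormal_iff hM hLC,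
    fun hN V W hV hW ↦ hD.nabla_eq_tanakaWebster hM hLC hN hV hW⟩
  · ext1 x
    exact eq_of_contactTorsion hM (hD.preservesD hM hLC) hD.parallel (hD.hasContactTorsion hM hLC)
      (hD.metricAlongD hM hLC) h1 h2 h3 h4 hW x (V x)
  · exact (isKContact_iff hM hLC).trans (hD.parallelMetric_iff hM hLC).symm
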